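/- In the Euclidean plane let $\mathcal C$ be a circle and let $\mathcal I$ be a circle (of positive radius) whose centre $D$ does not lie on $\mathcal C$. Poles and polars are taken with respect to $\mathcal I$. Consider triangles $ABC$ inscribed in $\mathcal C$ such that $D$ lies on none of the side lines (a "side" is the full line through two vertices). Let $A_p,B_p,C_p$ be the poles of the sides $BC,CA,AB$; the triangle $A_pB_pC_p$ is the polar triangle of $ABC$. A conic is a nondegenerate real conic (ellipse, circle, parabola or hyperbola), and tangency is understood in the projective plane, so that the asymptotes of a hyperbola count as tangents (the centre of a circle counts as its focus). (i) For every family of such triangles the following are equivalent: (a) there is a fixed circle $\mathcal C_p$ on which the poles of the sides of all triangles of the family lie; (b) there is one fixed conic $\gamma_D$ with focus $D$ to which the sides of all triangles of the family are tangent. More precisely, for each circle $\mathcal C_p$ there is a conic $\gamma_D$ with focus $D$, and for each conic $\gamma_D$ with focus $D$ there is a circle $\mathcal C_p$, such that for every such triangle the poles of its sides lie on $\mathcal C_p$ if and only if its sides are tangent to $\gamma_D$. (ii) There is a fixed conic $\Gamma_p$ with focus $D$ (depending only on $\mathcal C$ and $\mathcal I$) such that, for every family as in (i) which satisfies the equivalent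 conditions (a), (b), the sides of the polar triangles of all triangles of the family are tangent to $\Gamma_p$. -/

import Mathlib

open EuclideanGeometry Matrix

/-- The Euclidean plane. -/
abbrev Plane : Type := EuclideanSpace ℝ (Fin 2)

/-- The polar of a point `P` with respect to the circle `I` with centre `D` and radius `r`:
the line `{X | ⟨X - D, P - D⟩ = r ^ 2}` (a line exactly when `P ≠ D`). -/
def polar (I : Sphere Plane) (P : Plane) : AffineSubspace ℝ Plane where
  carrier := {X | inner ℝ (X - I.center) (P - I.center) = I.radius ^ 2}
  smul_vsub_vadd_mem' := by
    intro c X Y Z hX hY hZ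
    simp only [Set.mem_ofPred_eq, vsub_eq_sub, vadd_eq_add] at *
    have h : c • (X - Y) + Z - I.center
        = c • ((X - I.center) - (Y - I.center)) + (Z - I.center) := by
      simp only [sub_sub_sub_cancel_right]; abel
    rw [h, inner_add_left, inner_smul_left, inner_sub_left, hX, hY, hZ]
    simp

open Classical in
/-- The pole of a line `L` with respect to the circle `I`: the point whose polar is `L`.
(It exists and is unique for every line that misses the centre of `I`, see `polar_pole` and
`pole_polar`; the value for other `L` is irrelevant.) -/
noncomputable def pole (I : Sphere Plane) (L : AffineSubspace ℝ Plane) : Plane :=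
  if h : ∃ P, polar I P = L then h.choose else I.center

/-- The `i`-th side of the triangle with vertices `p 0, p 1, p 2`: the whole line through the two
vertices other than `p i` (indices modulo `3`). -/
noncomputable def sideLine (p : Fin 3 → Plane) (i : Fin 3) : AffineSubspace ℝ Plane :=
  affineSpan ℝ {p (i + 1), p (i + 2)}

/-- The vertices of the polar triangle: the `i`-th one is the pole of the `i`-th side. -/
noncomputable def polarTriangle (I : Sphere Plane) (p : Fin 3 → Plane) : Fin 3 → Plane :=
  fun i => pole I (sideLine p i)

/-- The triangle `T` is inscribed in the circle `C`, and the point `D` lies on none of its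
side lines. -/
def InscribedAvoiding (C : Sphere Plane) (D : Plane) (T : Affine.Triangle ℝ Plane) : Prop :=
  (∀ i, T.points i ∈ C) ∧ ∀ i, D ∉ sideLine T.points i

/-- Homogeneous coordinates of a point of the affine plane. -/
def homog (X : Plane) : Fin 3 → ℝ := ![X 0, X 1, 1]

/-- The linear subspace of `ℝ³` that represents the projective closure of a line of the plane. -/
def projClosure (L : AffineSubspace ℝ Plane) : Submodule ℝ (Fin 3 → ℝ) :=
  Submodule.span ℝ (homog '' (L : Set Plane))

/-- A nondegenerate real conic, given by a nonsingular symmetric matrix whose quadratic form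
`v ↦ vᵀ M v` has a nontrivial real zero. Its points are the points `[v]` of the real projective
plane with `vᵀ M v = 0`; in the affine plane it is an ellipse (possibly a circle), a parabola or a
hyperbola. -/
structure Conic where
  M : Matrix (Fin 3) (Fin 3) ℝ
  symm : M.IsSymm
  nondegenerate : M.det ≠ 0
  real_point : ∃ v : Fin 3 → ℝ, v ≠ 0 ∧ v ⬝ᵥ (M *ᵥ v) = 0

/-- The line `L` is tangent to the conic `γ`: for some point `[v]` of `γ`, it is the tangent
`{w | vᵀ M w = 0}` of `γ` at `[v]`. The point of contact may be at infinity, so the asymptotes of a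
hyperbola are tangents of it. -/
def Conic.IsTangent (γ : Conic) (L : AffineSubspace ℝ Plane) : Prop :=
  ∃ v : Fin 3 → ℝ, v ≠ 0 ∧ v ⬝ᵥ (γ.M *ᵥ v) = 0 ∧
    ∀ w, w ∈ projClosure L ↔ v ⬝ᵥ (γ.M *ᵥ w) = 0

/-- `D` is a focus of `γ` (focus-directrix property): up to a factor, the equation of `γ` is
`|X - D|² = f(X)²` with an affine function `f(X) = a X₀ + b X₁ + k`. If `(a, b) ≠ 0`, then the line
`f = 0` is the directrix, `e = |(a, b)|` the eccentricity and `|f(X)|` is `e` times the distance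
from `X` to the directrix; if `(a, b) = 0`, then `γ` is a circle with centre `D`. -/
def Conic.IsFocus (γ : Conic) (D : Plane) : Prop :=
  ∃ c a b k : ℝ, c ≠ 0 ∧ ∀ X : Plane,
    homog X ⬝ᵥ (γ.M *ᵥ homog X) = c * (dist X D ^ 2 - (a * X 0 + b * X 1 + k) ^ 2)

theorem mem_polar_iff (I : Sphere Plane) (P X : Plane) :
    X ∈ polar I P ↔ (X 0 - I.center 0) * (P 0 - I.center 0)
      + (X 1 - I.center 1) * (P 1 - I.center 1) = I.radius ^ 2 := by
  change inner ℝ (X - I.center) (P - I.center) = I.radius ^ 2 ↔ _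
  simp [PiLp.inner_apply, Fin.sum_univ_two, mul_comm]

/-- Every line that misses the centre of `I` is the polar of its pole. -/
theorem polar_pole (I : Sphere Plane) (hI : 0 < I.radius) (A B : Plane) (hAB : A ≠ B)
    (hD : I.center ∉ affineSpan ℝ {A, B}) :
    polar I (pole I (affineSpan ℝ {A, B})) = affineSpan ℝ {A, B} := by
  have hex : ∃ P, polar I P = affineSpan ℝ {A, B} := by
    obtain ⟨D, r⟩ := I
    simp only at hI hD
    set u := B 0 - A 0 with hu
    set v := B 1 - A 1 with hv
    have huv : u ^ 2 + v ^ 2 ≠ 0 := by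
      intro h
      apply hAB
      have h0 : u = 0 := by nlinarith [sq_nonneg u, sq_nonneg v]
      have h1 : v = 0 := by nlinarith [sq_nonneg u, sq_nonneg v]
      ext i
      fin_cases i
      · change A 0 = B 0; linarith
      · change A 1 = B 1; linarith
    have key : ∀ X : Plane, X ∈ affineSpan ℝ {A, B} ↔ -v * (X 0 - A 0) + u * (X 1 - A 1) = 0 := by
      intro X
      rw [mem_affineSpan_pair_iff_exists_lineMap_eq]
      constructor
      · rintro ⟨t, rfl⟩
        simp [AffineMap.lineMap_apply, hu, hv]
        ring
      · intro h
        refine ⟨(u * (X 0 - A 0) + v * (X 1 - A 1)) / (u ^ 2 + v ^ 2), ?_⟩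
        ext i
        fin_cases i
        · simp [AffineMap.lineMap_apply, ← hu]
          field_simp
          linear_combination v * h
        · simp [AffineMap.lineMap_apply, ← hv]
          field_simp
          linear_combination -u * h
    rw [key] at hD
    set c := -v * (D 0 - A 0) + u * (D 1 - A 1) with hc
    refine ⟨!₂[D 0 + r ^ 2 / c * v, D 1 - r ^ 2 / c * u], ?_⟩
    ext X
    rw [mem_polar_iff, key]
    simp
    have hr : r ^ 2 ≠ 0 := by positivity
    constructor
    · intro h
      field_simp at h
      linear_combination (-1 : ℝ) * h - hc
    · intro h
      field_simp
      linear_combination (-1 : ℝ) * h - hc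
  rw [pole, dif_pos hex]
  exact hex.choose_spec

/-- Every point other than the centre of `I` is the pole of its polar. -/
theorem pole_polar (I : Sphere Plane) (hI : 0 < I.radius) (P : Plane) (hP : P ≠ I.center) :
    pole I (polar I P) = P := by
  have hex : ∃ Q, polar I Q = polar I P := ⟨P, rfl⟩
  rw [pole, dif_pos hex]
  have h := hex.choose_spec
  generalize hex.choose = Q at h
  obtain ⟨D, r⟩ := I
  simp only at hI hP
  have hr : r ^ 2 ≠ 0 := by positivity
  set a := P 0 - D 0 with ha
  set b := P 1 - D 1 with hb
  have hab : a ^ 2 + b ^ 2 ≠ 0 := by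
    intro h
    apply hP
    have h0 : a = 0 := by nlinarith [sq_nonneg a, sq_nonneg b]
    have h1 : b = 0 := by nlinarith [sq_nonneg a, sq_nonneg b]
    ext i
    fin_cases i
    · change P 0 = D 0; linarith
    · change P 1 = D 1; linarith
  have hmem : ∀ t : ℝ, (r ^ 2 / (a ^ 2 + b ^ 2) * a - t * b) * (Q 0 - D 0)
      + (r ^ 2 / (a ^ 2 + b ^ 2) * b + t * a) * (Q 1 - D 1) = r ^ 2 := by
    intro t
    have hX : (!₂[D 0 + (r ^ 2 / (a ^ 2 + b ^ 2) * a - t * b),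
        D 1 + (r ^ 2 / (a ^ 2 + b ^ 2) * b + t * a)] : Plane) ∈ polar ⟨D, r⟩ P := by
      rw [mem_polar_iff]
      simp [← ha, ← hb]
      field_simp
      ring
    rw [← h, mem_polar_iff] at hX
    simpa using hX
  have e0 := hmem 0
  have e1 := hmem 1
  have f1 : -b * (Q 0 - D 0) + a * (Q 1 - D 1) = 0 := by linear_combination e1 - e0
  have f0 : a * (Q 0 - D 0) + b * (Q 1 - D 1) = a ^ 2 + b ^ 2 := by
    field_simp at e0
    simp only [mul_zero, sub_zero, add_zero] at e0
    apply mul_left_cancel₀ hr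
    linear_combination e0
  ext i
  fin_cases i
  · change Q 0 = P 0
    apply mul_left_cancel₀ hab
    linear_combination a * f0 - b * f1 + (a ^ 2 + b ^ 2) * ha
  · change Q 1 = P 1
    apply mul_left_cancel₀ hab
    linear_combination b * f0 + a * f1 + (a ^ 2 + b ^ 2) * hb

/-! Write D for the centre of `I` and R for the square of its radius. Each side is the polar of its
pole, so everything reduces to reciprocation: for P ≠ D, the polar of P is tangent to |X - D|² =
f(X)², with f(X) = aX₀ + bX₁ + k, iff |κ(P - D) + R(a, b)| = R, where κ = f(D)
(`Conic.isTangent_polar_iff`). This describes the circle with centre D - (R/κ)(a, b) and radius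
R/|κ|. Every circle arises in this way, which matches circles with conics of focus D and gives (i).
For (ii), the sides of the polar triangle are the polars of the vertices (`sideLine_polarTriangle`).
The vertices lie on `C`, so Γ is the reciprocal of `C`. -/

/-- The projective closure of the polar of `P`, as the kernel of a linear form. -/
theorem mem_projClosure_polar_iff (I : Sphere Plane) (P : Plane) (hP : P ≠ I.center)
    (w : Fin 3 → ℝ) :
    w ∈ projClosure (polar I P) ↔
      (P 0 - I.center 0) * (w 0 - I.center 0 * w 2) + (P 1 - I.center 1) * (w 1 - I.center 1 * w 2)
        = I.radius ^ 2 * w 2 := by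
  constructor
  · intro h
    induction h using Submodule.span_induction with
    | mem x hx =>
      obtain ⟨X, hX, rfl⟩ := hx
      have hX' := (mem_polar_iff I P X).1 hX
      simp only [homog, cons_val]
      linear_combination hX'
    | zero => simp
    | add x y _ _ hx hy =>
      simp only [Pi.add_apply]
      linear_combination hx + hy
    | smul t x _ hx =>
      simp only [Pi.smul_apply, smul_eq_mul]
      linear_combination t * hx
  · intro h
    have hn : (P 0 - I.center 0) ^ 2 + (P 1 - I.center 1) ^ 2 ≠ 0 := by
      intro h0
      apply hP
      ext i
      fin_cases i
      · change P 0 = I.center 0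
        nlinarith [sq_nonneg (P 0 - I.center 0), sq_nonneg (P 1 - I.center 1)]
      · change P 1 = I.center 1
        nlinarith [sq_nonneg (P 0 - I.center 0), sq_nonneg (P 1 - I.center 1)]
    obtain ⟨X, hX⟩ : ∃ X : Plane, X ∈ polar I P := by
      refine ⟨!₂[I.center 0 + I.radius ^ 2 / ((P 0 - I.center 0) ^ 2 + (P 1 - I.center 1) ^ 2)
          * (P 0 - I.center 0),
        I.center 1 + I.radius ^ 2 / ((P 0 - I.center 0) ^ 2 + (P 1 - I.center 1) ^ 2)
          * (P 1 - I.center 1)], ?_⟩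
      rw [mem_polar_iff]
      simp
      field_simp
    have hX' := (mem_polar_iff I P X).1 hX
    -- Writing `w` as a multiple of `homog X` plus one affine point also covers points at infinity,
    -- where `w 2 = 0`.
    have hY : (!₂[w 0 - (w 2 - 1) * X 0, w 1 - (w 2 - 1) * X 1] : Plane) ∈ polar I P := by
      rw [mem_polar_iff]
      simp
      linear_combination h - (w 2 - 1) * hX'
    have hw : w = (w 2 - 1) • homog X
        + homog !₂[w 0 - (w 2 - 1) * X 0, w 1 - (w 2 - 1) * X 1] := by
      ext i
      fin_cases i <;> simp [homog]
    rw [hw]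
    exact add_mem (Submodule.smul_mem _ _ (Submodule.subset_span ⟨X, hX, rfl⟩))
      (Submodule.subset_span ⟨_, hY, rfl⟩)

/-! ### Conics in focus-directrix form -/

/-- The matrix of the quadratic form `|X - D|² - (a X₀ + b X₁ + k)²`. -/
def focalMatrix (D : Plane) (a b k : ℝ) : Matrix (Fin 3) (Fin 3) ℝ :=
  !![1 - a ^ 2, -(a * b), -D 0 - a * k;
     -(a * b), 1 - b ^ 2, -D 1 - b * k;
     -D 0 - a * k, -D 1 - b * k, D 0 ^ 2 + D 1 ^ 2 - k ^ 2]

theorem dotProduct_focalMatrix_mulVec (D : Plane) (a b k : ℝ) (v w : Fin 3 → ℝ) :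
    v ⬝ᵥ (focalMatrix D a b k *ᵥ w) =
      (v 0 - D 0 * v 2) * (w 0 - D 0 * w 2) + (v 1 - D 1 * v 2) * (w 1 - D 1 * w 2)
        - (a * v 0 + b * v 1 + k * v 2) * (a * w 0 + b * w 1 + k * w 2) := by
  simp [focalMatrix, dotProduct, mulVec, Fin.sum_univ_three]
  ring

/-- Shows that nondegeneracy means f(D) ≠ 0, i.e. the focus is off the directrix. -/
theorem det_focalMatrix (D : Plane) (a b k : ℝ) :
    (focalMatrix D a b k).det = -(a * D 0 + b * D 1 + k) ^ 2 := by
  simp [focalMatrix, det_fin_three]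
  ring

theorem homog_dotProduct_focalMatrix (D : Plane) (a b k : ℝ) (X : Plane) :
    homog X ⬝ᵥ (focalMatrix D a b k *ᵥ homog X)
      = dist X D ^ 2 - (a * X 0 + b * X 1 + k) ^ 2 := by
  rw [dotProduct_focalMatrix_mulVec, EuclideanSpace.dist_eq, Real.sq_sqrt (by positivity)]
  simp [homog, Fin.sum_univ_two, Real.dist_eq, sq_abs]
  ring

/-- A symmetric matrix is determined by its quadratic form on the affine plane. -/
theorem Matrix.IsSymm.eq_of_homog_dotProduct {M N : Matrix (Fin 3) (Fin 3) ℝ} (hM : M.IsSymm)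
    (hN : N.IsSymm)
    (h : ∀ X : Plane, homog X ⬝ᵥ (M *ᵥ homog X) = homog X ⬝ᵥ (N *ᵥ homog X)) : M = N := by
  -- Six values suffice for the six coefficients.
  have h00 := h !₂[0, 0]
  have h10 := h !₂[1, 0]
  have h20 := h !₂[-1, 0]
  have h01 := h !₂[0, 1]
  have h02 := h !₂[0, -1]
  have h11 := h !₂[1, 1]
  have a1 := hM.apply 0 1
  have a2 := hM.apply 0 2
  have a3 := hM.apply 1 2
  have b1 := hN.apply 0 1
  have b2 := hN.apply 0 2
  have b3 := hN.apply 1 2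
  simp [homog, dotProduct, mulVec, Fin.sum_univ_three, a1, a2, a3, b1, b2, b3]
    at h00 h10 h20 h01 h02 h11
  ext i j
  fin_cases i <;> fin_cases j <;> simp only [Fin.zero_eta, Fin.mk_one, Fin.reduceFinMk] <;>
    linarith

theorem focalMatrix_isSymm (D : Plane) (a b k : ℝ) : (focalMatrix D a b k).IsSymm := by
  ext i j
  fin_cases i <;> fin_cases j <;> simp [focalMatrix]

/-- The conic `|X - D|² = (a X₀ + b X₁ + k)²`, for `D` not on the line `a X₀ + b X₁ + k = 0`. -/
def focalConic (D : Plane) (a b k : ℝ) (hk : a * D 0 + b * D 1 + k ≠ 0) : Conic where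
  M := focalMatrix D a b k
  symm := focalMatrix_isSymm D a b k
  nondegenerate := by
    rw [det_focalMatrix]
    exact neg_ne_zero.2 (pow_ne_zero 2 hk)
  real_point := by
    -- The third coordinate z is chosen to make the linear form equal to 1 at the point (1, 0) + zD,
    -- which matches |(1, 0)|² = 1.
    set z := (1 - a) / (a * D 0 + b * D 1 + k) with hz
    have hz' : z * (a * D 0 + b * D 1 + k) = 1 - a := div_mul_cancel₀ _ hk
    refine ⟨![1 + D 0 * z, D 1 * z, z], ?_, ?_⟩
    · intro h
      have h0 := congrFun h 0
      have h2 := congrFun h 2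
      simp at h0 h2
      simp [h2] at h0
    · rw [dotProduct_focalMatrix_mulVec]
      simp only [cons_val]
      linear_combination -(z * (a * D 0 + b * D 1 + k) + a + 1) * hz'

theorem focalConic_isFocus (D : Plane) (a b k : ℝ) (hk : a * D 0 + b * D 1 + k ≠ 0) :
    (focalConic D a b k hk).IsFocus D :=
  ⟨1, a, b, k, one_ne_zero, fun X => by
    rw [one_mul]
    exact homog_dotProduct_focalMatrix D a b k X⟩

theorem Conic.IsFocus.exists_eq_smul_focalMatrix {γ : Conic} {D : Plane} (h : γ.IsFocus D) :
    ∃ c a b k : ℝ, c ≠ 0 ∧ a * D 0 + b * D 1 + k ≠ 0 ∧ γ.M = c • focalMatrix D a b k := by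
  obtain ⟨c, a, b, k, hc, h⟩ := h
  have hM : γ.M = c • focalMatrix D a b k := by
    refine γ.symm.eq_of_homog_dotProduct ((focalMatrix_isSymm D a b k).smul c) fun X => ?_
    rw [h, smul_mulVec, dotProduct_smul, homog_dotProduct_focalMatrix, smul_eq_mul]
  refine ⟨c, a, b, k, hc, fun h0 => γ.nondegenerate ?_, hM⟩
  rw [hM, det_smul, det_focalMatrix, h0]
  simp

/-! ### Reciprocation between circles and conics -/

/-- The polar of `P` is tangent to the conic `|X - D|² = (a X₀ + b X₁ + k)²` with focus at the
centre `D` of `I` iff `P` lies on a certain circle. -/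
theorem Conic.isTangent_polar_iff (I : Sphere Plane) (hI : 0 < I.radius) (γ : Conic)
    (c a b k : ℝ) (hc : c ≠ 0) (hk : a * I.center 0 + b * I.center 1 + k ≠ 0)
    (hM : γ.M = c • focalMatrix I.center a b k) (P : Plane) (hP : P ≠ I.center) :
    γ.IsTangent (polar I P) ↔
      ((a * I.center 0 + b * I.center 1 + k) * (P 0 - I.center 0) + a * I.radius ^ 2) ^ 2
        + ((a * I.center 0 + b * I.center 1 + k) * (P 1 - I.center 1) + b * I.radius ^ 2) ^ 2
        = (I.radius ^ 2) ^ 2 := by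
  have hr : I.radius ^ 2 ≠ 0 := by positivity
  simp only [Conic.IsTangent, mem_projClosure_polar_iff I P hP, hM, smul_mulVec, dotProduct_smul,
    dotProduct_focalMatrix_mulVec, smul_eq_mul, mul_eq_zero, hc, false_or]
  generalize I.radius ^ 2 = R at *
  generalize P 0 - I.center 0 = m at *
  generalize P 1 - I.center 1 = n at *
  generalize I.center 0 = x₀ at *
  generalize I.center 1 = y₀ at *
  obtain ⟨κ, hκ⟩ : ∃ κ, κ = a * x₀ + b * y₀ + k := ⟨_, rfl⟩
  rw [← hκ] at hk ⊢
  constructor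
  · rintro ⟨v, hv, hq, hl⟩
    -- These two vectors span the projective closure of the polar. In coordinates centred at D they
    -- are (R, 0, m) and (0, R, n).
    have e0 := (hl ![R + x₀ * m, y₀ * m, m]).1 (by simp; ring)
    have e1 := (hl ![x₀ * n, R + y₀ * n, n]).1 (by simp; ring)
    simp only [cons_val] at e0 e1
    obtain ⟨s, hs⟩ : ∃ s, s = a * v 0 + b * v 1 + k * v 2 := ⟨_, rfl⟩
    rw [← hs] at e0 e1 hq
    have f0 : (v 0 - x₀ * v 2) * R = s * (κ * m + a * R) := by
      rw [hκ]; linear_combination e0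
    have f1 : (v 1 - y₀ * v 2) * R = s * (κ * n + b * R) := by
      rw [hκ]; linear_combination e1
    -- If s = 0, then v is a multiple of (D, 1) on which the linear form vanishes; since κ ≠ 0, this
    -- forces v = 0.
    have hs0 : s ≠ 0 := by
      intro h0
      rw [h0, zero_mul] at f0 f1
      have g0 := (mul_eq_zero.1 f0).resolve_right hr
      have g1 := (mul_eq_zero.1 f1).resolve_right hr
      have g2 : κ * v 2 = 0 := by
        rw [hκ]; linear_combination h0 - hs - a * g0 - b * g1
      have g2 := (mul_eq_zero.1 g2).resolve_left hk
      rw [g2] at g0 g1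
      apply hv
      ext i
      fin_cases i
      · simpa using g0
      · simpa using g1
      · exact g2
    apply mul_left_cancel₀ (pow_ne_zero 2 hs0)
    linear_combination R ^ 2 * hq - (s * (κ * m + a * R) + (v 0 - x₀ * v 2) * R) * f0
      - (s * (κ * n + b * R) + (v 1 - y₀ * v 2) * R) * f1
  · intro h
    obtain ⟨x, hx⟩ : ∃ x, x = κ * m + a * R := ⟨_, rfl⟩
    obtain ⟨y, hy⟩ : ∃ y, y = κ * n + b * R := ⟨_, rfl⟩
    -- The contact point, scaled so that the linear form takes the value R there; z is solved from
    -- this condition.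
    obtain ⟨z, hz⟩ : ∃ z, κ * z = R - a * x - b * y := ⟨_, mul_div_cancel₀ _ hk⟩
    rw [← hx, ← hy] at h
    have hf : a * (x + x₀ * z) + b * (y + y₀ * z) + k * z = R := by
      rw [hκ] at hz; linear_combination hz
    refine ⟨![x + x₀ * z, y + y₀ * z, z], ?_, ?_, fun w => ?_⟩
    · intro h0
      have g0 := congrFun h0 0
      have g1 := congrFun h0 1
      have g2 := congrFun h0 2
      simp only [cons_val, Pi.zero_apply] at g0 g1 g2
      rw [g0, g1, g2] at hf
      exact hr (by linear_combination -hf)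
    · simp only [cons_val, hf]
      linear_combination h
    · simp only [cons_val, hf]
      have key : (x + x₀ * z - x₀ * z) * (w 0 - x₀ * w 2) + (y + y₀ * z - y₀ * z) * (w 1 - y₀ * w 2)
          - R * (a * w 0 + b * w 1 + k * w 2)
          = κ * (m * (w 0 - x₀ * w 2) + n * (w 1 - y₀ * w 2) - R * w 2) := by
        rw [hx, hy, hκ]; ring
      rw [key, mul_eq_zero, or_iff_right hk, sub_eq_zero]

theorem Plane.mem_sphere_iff (S : Sphere Plane) (hS : 0 ≤ S.radius) (P : Plane) :
    P ∈ S ↔ (P 0 - S.center 0) ^ 2 + (P 1 - S.center 1) ^ 2 = S.radius ^ 2 := by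
  rw [EuclideanGeometry.mem_sphere, ← sq_eq_sq₀ dist_nonneg hS, EuclideanSpace.dist_eq,
    Real.sq_sqrt (by positivity)]
  simp [Fin.sum_univ_two, Real.dist_eq, sq_abs]

/-- The polar reciprocal of a circle is a conic with focus at the centre of reciprocation. -/
theorem exists_conic_isTangent_polar_iff_mem (I S : Sphere Plane) (hI : 0 < I.radius)
    (hS : 0 < S.radius) :
    ∃ γ : Conic, γ.IsFocus I.center ∧
      ∀ P : Plane, P ≠ I.center → (γ.IsTangent (polar I P) ↔ P ∈ S) := by
  -- Solves centre = D - (R/κ)(a, b) and radius = R/κ for a, b and κ > 0.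
  obtain ⟨a, ha⟩ : ∃ a, a * S.radius = -(S.center 0 - I.center 0) :=
    ⟨_, div_mul_cancel₀ _ hS.ne'⟩
  obtain ⟨b, hb⟩ : ∃ b, b * S.radius = -(S.center 1 - I.center 1) :=
    ⟨_, div_mul_cancel₀ _ hS.ne'⟩
  obtain ⟨κ, hκ⟩ : ∃ κ, κ * S.radius = I.radius ^ 2 := ⟨_, div_mul_cancel₀ _ hS.ne'⟩
  have hr : I.radius ^ 2 ≠ 0 := by positivity
  have hκ0 : κ ≠ 0 := by
    rintro rfl
    exact hr (by rw [← hκ, zero_mul])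
  have hk : a * I.center 0 + b * I.center 1 + (κ - a * I.center 0 - b * I.center 1) = κ := by ring
  have hk0 : a * I.center 0 + b * I.center 1 + (κ - a * I.center 0 - b * I.center 1) ≠ 0 := by
    rwa [hk]
  refine ⟨focalConic I.center a b _ hk0, focalConic_isFocus _ _ _ _ hk0, fun P hP => ?_⟩
  rw [Conic.isTangent_polar_iff I hI _ 1 a b _ one_ne_zero hk0 (one_smul _ _).symm P hP, hk,
    Plane.mem_sphere_iff S hS.le P, ← hκ]
  have e0 : κ * (P 0 - I.center 0) + a * (κ * S.radius) = κ * (P 0 - S.center 0) := by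
    linear_combination κ * ha
  have e1 : κ * (P 1 - I.center 1) + b * (κ * S.radius) = κ * (P 1 - S.center 1) := by
    linear_combination κ * hb
  rw [e0, e1, mul_pow, mul_pow, mul_pow, ← mul_add, mul_right_inj' (pow_ne_zero 2 hκ0)]

/-- The polar reciprocal of a conic with respect to a circle centred at its focus is a circle. -/
theorem Conic.IsFocus.exists_sphere_isTangent_polar_iff_mem (I : Sphere Plane) (hI : 0 < I.radius)
    {γ : Conic} (hγ : γ.IsFocus I.center) :
    ∃ S : Sphere Plane, 0 < S.radius ∧
      ∀ P : Plane, P ≠ I.center → (γ.IsTangent (polar I P) ↔ P ∈ S) := by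
  obtain ⟨c, a, b, k, hc, hk, hM⟩ := hγ.exists_eq_smul_focalMatrix
  obtain ⟨κ, hκ⟩ : ∃ κ, κ = a * I.center 0 + b * I.center 1 + k := ⟨_, rfl⟩
  have hκ0 : κ ≠ 0 := hκ ▸ hk
  have hpos : 0 < I.radius ^ 2 / |κ| := div_pos (by positivity) (abs_pos.2 hκ0)
  refine ⟨⟨!₂[I.center 0 - a * I.radius ^ 2 / κ, I.center 1 - b * I.radius ^ 2 / κ],
    I.radius ^ 2 / |κ|⟩, hpos, fun P hP => ?_⟩
  rw [Conic.isTangent_polar_iff I hI γ c a b k hc hk hM P hP, Plane.mem_sphere_iff _ hpos.le P,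
    ← hκ, div_pow, sq_abs, eq_div_iff (pow_ne_zero 2 hκ0)]
  simp only [cons_val]
  have e0 : κ * (P 0 - I.center 0) + a * I.radius ^ 2
      = (P 0 - (I.center 0 - a * I.radius ^ 2 / κ)) * κ := by field_simp; ring
  have e1 : κ * (P 1 - I.center 1) + b * I.radius ^ 2
      = (P 1 - (I.center 1 - b * I.radius ^ 2 / κ)) * κ := by field_simp; ring
  rw [e0, e1, mul_pow, mul_pow, add_mul]

/-! ### Sides of the polar triangle -/

theorem triangle_points_ne (T : Affine.Triangle ℝ Plane) (i : Fin 3) :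
    T.points (i + 1) ≠ T.points (i + 2) :=
  T.independent.injective.ne (by revert i; decide)

theorem polar_pole_sideLine (I : Sphere Plane) (hI : 0 < I.radius) (T : Affine.Triangle ℝ Plane)
    (i : Fin 3) (hD : I.center ∉ sideLine T.points i) :
    polar I (pole I (sideLine T.points i)) = sideLine T.points i :=
  polar_pole I hI _ _ (triangle_points_ne T i) hD

theorem center_ne_of_mem_polar (I : Sphere Plane) (hI : 0 < I.radius) {P X : Plane}
    (h : X ∈ polar I P) : P ≠ I.center := by
  rintro rfl
  rw [mem_polar_iff] at h
  have : 0 < I.radius ^ 2 := by positivity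
  simp only [sub_self, mul_zero, add_zero] at h
  exact this.ne h

theorem pole_sideLine_ne_center (I : Sphere Plane) (hI : 0 < I.radius)
    (T : Affine.Triangle ℝ Plane) (i : Fin 3) (hD : I.center ∉ sideLine T.points i) :
    pole I (sideLine T.points i) ≠ I.center := by
  have h : T.points (i + 1) ∈ polar I (pole I (sideLine T.points i)) := by
    rw [polar_pole_sideLine I hI T i hD]
    exact left_mem_affineSpan_pair ℝ _ _
  exact center_ne_of_mem_polar I hI h

theorem mem_polar_comm (I : Sphere Plane) (P Q : Plane) : P ∈ polar I Q ↔ Q ∈ polar I P := by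
  rw [mem_polar_iff, mem_polar_iff, mul_comm, mul_comm (P 1 - _)]

/-- The line AB is the polar of its own pole Q, and P - Q is orthogonal to A - D and B - D. These
are independent, so P = Q. -/
theorem affineSpan_pair_eq_polar (I : Sphere Plane) (hI : 0 < I.radius) {A B P : Plane}
    (hAB : A ≠ B) (hA : A ∈ polar I P) (hB : B ∈ polar I P) :
    affineSpan ℝ {A, B} = polar I P := by
  have hle : affineSpan ℝ {A, B} ≤ polar I P := by
    rw [affineSpan_le]
    rintro X (rfl | rfl)
    exacts [hA, hB]
  have hD : I.center ∉ affineSpan ℝ {A, B} := by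
    intro h
    have h' := (mem_polar_iff I P _).1 (hle h)
    have : 0 < I.radius ^ 2 := by positivity
    simp only [sub_self, zero_mul, add_zero] at h'
    exact this.ne h'
  refine le_antisymm hle ?_
  have hpole := polar_pole I hI A B hAB hD
  generalize pole I (affineSpan ℝ {A, B}) = Q at hpole
  have hQA : A ∈ polar I Q := hpole ▸ left_mem_affineSpan_pair ℝ A B
  have hQB : B ∈ polar I Q := hpole ▸ right_mem_affineSpan_pair ℝ A B
  suffices h : P = Q by rw [h, hpole]
  rw [mem_polar_iff] at hA hB hQA hQB
  have hA' : (A 0 - I.center 0) * (P 0 - Q 0) + (A 1 - I.center 1) * (P 1 - Q 1) = 0 := by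
    linear_combination hA - hQA
  have hB' : (B 0 - I.center 0) * (P 0 - Q 0) + (B 1 - I.center 1) * (P 1 - Q 1) = 0 := by
    linear_combination hB - hQB
  have hr : I.radius ^ 2 ≠ 0 := by positivity
  set d := (A 0 - I.center 0) * (B 1 - I.center 1) - (A 1 - I.center 1) * (B 0 - I.center 0)
    with hd
  have hd0 : d ≠ 0 := by
    intro h0
    apply hAB
    ext i
    apply mul_left_cancel₀ hr
    fin_cases i
    · change I.radius ^ 2 * A 0 = I.radius ^ 2 * B 0
      linear_combination (P 1 - I.center 1) * (h0 - hd) - (A 0 - I.center 0) * hB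
        + (B 0 - I.center 0) * hA
    · change I.radius ^ 2 * A 1 = I.radius ^ 2 * B 1
      linear_combination -(P 0 - I.center 0) * (h0 - hd) - (A 1 - I.center 1) * hB
        + (B 1 - I.center 1) * hA
  ext i
  apply mul_left_cancel₀ hd0
  fin_cases i
  · change d * P 0 = d * Q 0
    linear_combination (P 0 - Q 0) * hd + (B 1 - I.center 1) * hA' - (A 1 - I.center 1) * hB'
  · change d * P 1 = d * Q 1
    linear_combination (P 1 - Q 1) * hd + (A 0 - I.center 0) * hB' - (B 0 - I.center 0) * hA'

/-- Keeps the vertices of the polar triangle distinct: by affine independence no vertex lies on its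
opposite side. -/
theorem sideLine_add_one_ne_sideLine_add_two (T : Affine.Triangle ℝ Plane) (i : Fin 3) :
    sideLine T.points (i + 1) ≠ sideLine T.points (i + 2) := by
  intro h
  have hmem : T.points (i + 2) ∈ sideLine T.points (i + 2) := by
    rw [← h, sideLine, show i + 1 + 1 = i + 2 by clear h; decide +revert]
    exact left_mem_affineSpan_pair ℝ _ _
  rw [sideLine, ← Set.image_pair, T.independent.mem_affineSpan_iff] at hmem
  simp only [Set.mem_insert_iff, Set.mem_singleton_iff] at hmem
  exact absurd hmem (by clear hmem h; decide +revert)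

/-- The sides of the polar triangle are the polars of the vertices. -/
theorem sideLine_polarTriangle (I : Sphere Plane) (hI : 0 < I.radius)
    (T : Affine.Triangle ℝ Plane) (hD : ∀ i, I.center ∉ sideLine T.points i) (i : Fin 3) :
    sideLine (polarTriangle I T.points) i = polar I (T.points i) := by
  refine affineSpan_pair_eq_polar I hI (fun h => ?_) ?_ ?_
  · apply sideLine_add_one_ne_sideLine_add_two T i
    rw [← polar_pole_sideLine I hI T (i + 1) (hD _), ← polar_pole_sideLine I hI T (i + 2) (hD _)]
    exact congrArg (polar I) h
  -- By reciprocity it is enough that vertex `i` lies on the sides `i + 1` and `i + 2`.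
  · rw [mem_polar_comm, polarTriangle, polar_pole_sideLine I hI T _ (hD _), sideLine,
      show i + 1 + 2 = i by revert i; decide]
    exact right_mem_affineSpan_pair ℝ _ _
  · rw [mem_polar_comm, polarTriangle, polar_pole_sideLine I hI T _ (hD _), sideLine,
      show i + 2 + 1 = i by revert i; decide]
    exact left_mem_affineSpan_pair ℝ _ _

theorem mainTheorem7 (C I : Sphere Plane) (hC : 0 < C.radius) (hI : 0 < I.radius)
    (hD : I.center ∉ C) :
    -- for every family `S` of triangles inscribed in `C`
    (∀ S : Set (Affine.Triangle ℝ Plane), (∀ T ∈ S, InscribedAvoiding C I.center T) →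
      ((∃ Cp : Sphere Plane, 0 < Cp.radius ∧
          ∀ T ∈ S, ∀ i, pole I (sideLine T.points i) ∈ Cp) ↔
        ∃ γ : Conic, γ.IsFocus I.center ∧ ∀ T ∈ S, ∀ i, γ.IsTangent (sideLine T.points i))) ∧
    -- a given circle `Cp` has such a conic `γ` for all triangles at once, and vice versa
    (∀ Cp : Sphere Plane, 0 < Cp.radius → ∃ γ : Conic, γ.IsFocus I.center ∧
      ∀ T : Affine.Triangle ℝ Plane, InscribedAvoiding C I.center T →
        ((∀ i, pole I (sideLine T.points i) ∈ Cp) ↔ ∀ i, γ.IsTangent (sideLine T.points i))) ∧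
    (∀ γ : Conic, γ.IsFocus I.center → ∃ Cp : Sphere Plane, 0 < Cp.radius ∧
      ∀ T : Affine.Triangle ℝ Plane, InscribedAvoiding C I.center T →
        ((∀ i, pole I (sideLine T.points i) ∈ Cp) ↔ ∀ i, γ.IsTangent (sideLine T.points i))) ∧
    -- the sides of the polar triangles are tangent to a fixed conic, independent of the family
    (∃ Γ : Conic, Γ.IsFocus I.center ∧
      ∀ S : Set (Affine.Triangle ℝ Plane), (∀ T ∈ S, InscribedAvoiding C I.center T) →
        (∃ Cp : Sphere Plane, 0 < Cp.radius ∧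
          ∀ T ∈ S, ∀ i, pole I (sideLine T.points i) ∈ Cp) →
        ∀ T ∈ S, ∀ i, Γ.IsTangent (sideLine (polarTriangle I T.points) i)) := by
  have htangent : ∀ (γ : Conic) (S : Sphere Plane),
      (∀ P : Plane, P ≠ I.center → (γ.IsTangent (polar I P) ↔ P ∈ S)) →
      ∀ T : Affine.Triangle ℝ Plane, InscribedAvoiding C I.center T →
        ((∀ i, pole I (sideLine T.points i) ∈ S) ↔ ∀ i, γ.IsTangent (sideLine T.points i)) := by
    intro γ S h T hT
    refine forall_congr' fun i => ?_
    rw [← h _ (pole_sideLine_ne_center I hI T i (hT.2 i)), polar_pole_sideLine I hI T i (hT.2 i)]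
  have hconic : ∀ Cp : Sphere Plane, 0 < Cp.radius → ∃ γ : Conic, γ.IsFocus I.center ∧
      ∀ T : Affine.Triangle ℝ Plane, InscribedAvoiding C I.center T →
        ((∀ i, pole I (sideLine T.points i) ∈ Cp) ↔
          ∀ i, γ.IsTangent (sideLine T.points i)) := by
    intro Cp hCp
    obtain ⟨γ, hγ, h⟩ := exists_conic_isTangent_polar_iff_mem I Cp hI hCp
    exact ⟨γ, hγ, htangent γ Cp h⟩
  have hcircle : ∀ γ : Conic, γ.IsFocus I.center → ∃ Cp : Sphere Plane, 0 < Cp.radius ∧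
      ∀ T : Affine.Triangle ℝ Plane, InscribedAvoiding C I.center T →
        ((∀ i, pole I (sideLine T.points i) ∈ Cp) ↔
          ∀ i, γ.IsTangent (sideLine T.points i)) := by
    intro γ hγ
    obtain ⟨Cp, hCp, h⟩ := hγ.exists_sphere_isTangent_polar_iff_mem I hI
    exact ⟨Cp, hCp, htangent γ Cp h⟩
  refine ⟨fun S hS => ⟨?_, ?_⟩, hconic, hcircle, ?_⟩
  · rintro ⟨Cp, hCp, h⟩
    obtain ⟨γ, hγ, hT⟩ := hconic Cp hCp
    exact ⟨γ, hγ, fun T hTS => (hT T (hS T hTS)).1 (h T hTS)⟩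
  · rintro ⟨γ, hγ, h⟩
    obtain ⟨Cp, hCp, hT⟩ := hcircle γ hγ
    exact ⟨Cp, hCp, fun T hTS => (hT T (hS T hTS)).2 (h T hTS)⟩
  · obtain ⟨Γ, hΓ, h⟩ := exists_conic_isTangent_polar_iff_mem I C hI hC
    refine ⟨Γ, hΓ, fun S hS _ T hTS i => ?_⟩
    obtain ⟨hTC, hTD⟩ := hS T hTS
    -- As D is not on `C`, no vertex is D, so the reciprocal of `C` applies to its polar.
    rw [sideLine_polarTriangle I hI T hTD i, h _ fun h0 => hD (h0 ▸ hTC i)]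
    exact hTC i
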